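/- Let $S$ be a nonempty finite commutative semigroup, written additively. A sequence over $S$ is a finite unordered sequence of elements of $S$, repetition allowed; $|A|$ is the length and $\sigma(A)$ the sum of all terms of $A$. The empty sequence is allowed only if $S$ has an identity element $0_S$, and then its sum is $0_S$. Define: - $\mathsf D(S)$: the least positive integer $\ell$ such that every sequence $A$ over $S$ with $|A|\ge \ell$ has a proper subsequence $B$ with $\sigma(B)=\sigma(A)$; - the period of $a\in S$: the least positive integer $t$ such that $ra=(r+t)a$ for some integer $r>0$; $\exp(S)$: the least common multiple of the periods of all elements of $S$; and $\kappa(S)=\left\lceil \frac{|S|}{\exp(S)}\right\rceil\exp(S)$; - $\mathsf E(S)$: the least positive integer $\ell$ such that every sequence $A$ over $S$ of length $\ell$ has a subsequence $B$ with $\sigma(B)=\sigma(A)$ and $|A|-|B|=\kappa(S)$. Suppose that $S$ is archimedean, i.e. for any $a,b\in S$ there exist integers $m,n>0$ and $x,y\in S$ with $ma=b+x$ and $nb=a+y$. Let $K$ be the kernel of $S$ (its smallest nonempty ideal), and let $S/K$ be the Rees quotient semigroup, i.e. the quotient of $S$ by the congruence that identifies $a$ and $b$ if and only if $a=b$ or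 $a,b\in K$. The nilpotency index of a nilpotent commutative semigroup $N$ is the least positive integer $t$ such that the $t$-fold sumset $N+\cdots+N$ has exactly one element. Then $$\mathsf E(S)\le \mathsf D(S)+\kappa(S).$$ Moreover, if the nilpotency index of $S/K$ is at most three, then $$\mathsf E(S)\le \mathsf D(S)+\kappa(S)-1.$$ -/

import Mathlib

namespace ArchSemigroup

/-- `z` is an identity element (a neutral element) of the commutative semigroup `S`. -/
def IsIdentity {S : Type*} [AddCommSemigroup S] (z : S) : Prop :=
  ∀ a : S, z + a = a

/-- `SumsTo A s`: the finite sequence `A` (an unordered sequence with repetition allowed) of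
elements of `S` has the sum `s`. For a nonempty sequence the sum is computed in the monoid
`WithZero S`, which is `S` with a *new* identity adjoined. The empty sequence has a sum only if `S`
itself has an identity element, and its sum is then that identity element. -/
def SumsTo {S : Type*} [AddCommSemigroup S] (A : Multiset S) (s : S) : Prop :=
  (A.map (fun a : S => (a : WithZero S))).sum = (s : WithZero S) ∨ (A = 0 ∧ IsIdentity s)

/-- `σ(A) = σ(B)`, both sums being defined. -/
def SameSum {S : Type*} [AddCommSemigroup S] (A B : Multiset S) : Prop :=
  ∃ s : S, SumsTo A s ∧ SumsTo B s

/-- A sequence is reducible if some proper subsequence (possibly the empty one, when `S` has an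
identity element) has the same sum. On multisets, `B < A` means `B ≤ A` and `B ≠ A`. -/
def Reducible {S : Type*} [AddCommSemigroup S] (A : Multiset S) : Prop :=
  ∃ B : Multiset S, B < A ∧ SameSum B A

/-- The (large) Davenport constant `D(S)`: the least positive integer `ℓ` such that every sequence
of length at least `ℓ` is reducible; it is `⊤ = ∞` if there is no such `ℓ`. -/
noncomputable def davenport (S : Type*) [AddCommSemigroup S] : ℕ∞ :=
  sInf ((fun l : ℕ => (l : ℕ∞)) ''
    {l : ℕ | 0 < l ∧ ∀ A : Multiset S, l ≤ A.card → Reducible A})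

/-- A nonempty sequence has a sum. -/
theorem exists_sumsTo {S : Type*} [AddCommSemigroup S] (A : Multiset S) (hA : A ≠ 0) :
    ∃ s : S, SumsTo A s := by
  suffices h : ∀ A : Multiset S, A ≠ 0 →
      ∃ s : S, (A.map (fun a : S => (a : WithZero S))).sum = (s : WithZero S) by
    obtain ⟨s, hs⟩ := h A hA
    exact ⟨s, Or.inl hs⟩
  intro A
  induction A using Multiset.induction with
  | empty => intro h; exact absurd rfl h
  | cons a A ih =>
    intro _
    by_cases h0 : A = 0
    · exact ⟨a, by simp [h0]⟩
    · obtain ⟨s, hs⟩ := ih h0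
      exact ⟨a + s, by simp [hs]⟩

/-- The Davenport constant of a finite commutative semigroup is finite. -/
theorem davenport_ne_top (S : Type*) [AddCommSemigroup S] [Finite S] : davenport S ≠ ⊤ := by
  classical
  have := Fintype.ofFinite S
  have : Fintype (WithZero S) := inferInstanceAs (Fintype (Option S))
  suffices h : davenport S ≤ ((Fintype.card (WithZero S) + 1 : ℕ) : ℕ∞) from
    ne_top_of_le_ne_top (ENat.natCast_ne_top _) h
  refine sInf_le ⟨_, ⟨Nat.succ_pos _, fun A hA => ?_⟩, rfl⟩
  obtain ⟨L, rfl⟩ := Quot.exists_rep A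
  change Fintype.card (WithZero S) + 1 ≤ L.length at hA
  let c : S → WithZero S := fun a => (a : WithZero S)
  let f : Fin (Fintype.card (WithZero S) + 1) → WithZero S :=
    fun i => ((L.take (i + 1)).map c).sum
  obtain ⟨i, j, hij, hf⟩ : ∃ i j, i < j ∧ f i = f j := by
    obtain ⟨i, j, hne, hf⟩ := Fintype.exists_ne_map_eq_of_card_lt f (by simp)
    rcases lt_or_gt_of_ne hne with h | h
    · exact ⟨i, j, h, hf⟩
    · exact ⟨j, i, h, hf.symm⟩
  have hij' : (i : ℕ) < j := hij
  have hj := j.isLt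
  obtain ⟨s, hs⟩ := exists_sumsTo (L : Multiset S) (by
    intro h
    have := congrArg Multiset.card h
    simp at this
    simp [this] at hA)
  have hsum : ((L.take (i + 1) ++ L.drop (j + 1)).map c).sum = (L.map c).sum := by
    conv_rhs => rw [← List.take_append_drop (j + 1) L]
    rw [List.map_append, List.map_append, List.sum_append, List.sum_append]
    exact congrArg (· + _) hf
  refine ⟨(L.take (i + 1) ++ L.drop (j + 1) : List S), lt_of_le_of_ne ?_ ?_, s, ?_, hs⟩
  · refine Multiset.coe_le.2 (List.Sublist.subperm ?_)
    conv_rhs => rw [← List.take_append_drop (j + 1) L]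
    exact (List.take_sublist_take_left (by omega)).append (List.Sublist.refl _)
  · intro h
    have := congrArg Multiset.card h
    change (L.take (i + 1) ++ L.drop (j + 1)).length = L.length at this
    simp at this
    omega
  · rcases hs with hs | ⟨h, _⟩
    · left
      change ((L.take (i + 1) ++ L.drop (j + 1)).map c).sum = _
      rw [hsum]; exact hs
    · exfalso
      have := congrArg Multiset.card h
      simp at this
      simp [this] at hA

/-- The period of `a`: the least positive integer `t` with `r a = (r + t) a` for some `r > 0`.
Positive multiples of `a` are computed in `WithZero S`, into which `S` embeds. -/
noncomputable def period {S : Type*} [AddCommSemigroup S] (a : S) : ℕ :=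
  sInf {t : ℕ | 0 < t ∧ ∃ r : ℕ, 0 < r ∧ r • (a : WithZero S) = (r + t) • (a : WithZero S)}

/-- The exponent `exp(S)`: the least common multiple of the periods of all elements. -/
noncomputable def exponent (S : Type*) [AddCommSemigroup S] [Fintype S] : ℕ :=
  (Finset.univ : Finset S).lcm period

/-- `κ(S) = ⌈|S| / exp(S)⌉ exp(S)`. -/
noncomputable def kappa (S : Type*) [AddCommSemigroup S] [Fintype S] : ℕ :=
  ⌈(Fintype.card S : ℚ) / (exponent S : ℚ)⌉₊ * exponent S

/-- `E(S)`: the least positive integer `ℓ` such that every sequence `A` of length `ℓ` contains a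
subsequence `B` with `σ(B) = σ(A)` and `|A| - |B| = κ(S)`; it is `⊤ = ∞` if there is no such `ℓ`. -/
noncomputable def egz (S : Type*) [AddCommSemigroup S] [Fintype S] : ℕ∞ :=
  sInf ((fun l : ℕ => (l : ℕ∞)) ''
    {l : ℕ | 0 < l ∧ ∀ A : Multiset S, A.card = l →
      ∃ B : Multiset S, B ≤ A ∧ SameSum B A ∧ A.card = B.card + kappa S})

/-- `S` is archimedean: for all `a, b` there are `m, n > 0` and `x, y` in `S` with `m a = b + x`
and `n b = a + y`. -/
def IsArchimedean (S : Type*) [AddCommSemigroup S] : Prop :=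
  ∀ a b : S, ∃ m n : ℕ, 0 < m ∧ 0 < n ∧ ∃ x y : S,
    m • (a : WithZero S) = ((b + x : S) : WithZero S) ∧
    n • (b : WithZero S) = ((a + y : S) : WithZero S)

/-- The kernel of `S`: the intersection of all nonempty ideals. For a finite nonempty commutative
semigroup it is the smallest nonempty ideal. -/
def kernel (S : Type*) [AddCommSemigroup S] : AddSemigroupIdeal S where
  carrier := {a | ∀ I : AddSemigroupIdeal S, (I : Set S).Nonempty → a ∈ I}
  vadd_mem' := fun c {_} ha I hI => AddSemigroupIdeal.add_mem I c (ha I hI)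

/-- The Rees congruence of an ideal `I`: `a` and `b` are related if `a = b` or `a, b ∈ I`. -/
def reesCon {S : Type*} [AddCommSemigroup S] (I : AddSemigroupIdeal S) : AddCon S where
  r a b := a = b ∨ (a ∈ I ∧ b ∈ I)
  iseqv := by
    refine ⟨fun a => Or.inl rfl, ?_, ?_⟩
    · rintro a b (h | h)
      · exact Or.inl h.symm
      · exact Or.inr h.symm
    · rintro a b c (rfl | h) (rfl | h')
      · exact Or.inl rfl
      · exact Or.inr h'
      · exact Or.inr h
      · exact Or.inr ⟨h.1, h'.2⟩
  add' := by
    have key : ∀ x y : S, x ∈ I → x + y ∈ I := fun x y hx => by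
      rw [add_comm]; exact AddSemigroupIdeal.add_mem I y hx
    rintro w x y z (rfl | h) (rfl | h')
    · exact Or.inl rfl
    · exact Or.inr ⟨AddSemigroupIdeal.add_mem I w h'.1, AddSemigroupIdeal.add_mem I w h'.2⟩
    · exact Or.inr ⟨key _ _ h.1, key _ _ h.2⟩
    · exact Or.inr ⟨key _ _ h.1, key _ _ h.2⟩

/-- The Rees quotient semigroup `S / I`. -/
abbrev ReesQuotient {S : Type*} [AddCommSemigroup S] (I : AddSemigroupIdeal S) : Type _ :=
  (reesCon I).Quotient

/-- The `t`-fold sumset `N + ⋯ + N` (for `t > 0`): all sums of `t` elements of `N`. -/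
def foldSumset (N : Type*) [AddCommSemigroup N] (t : ℕ) : Set N :=
  {s | ∃ A : Multiset N, A.card = t ∧ SumsTo A s}

/-- The nilpotency index of `N`: the least `t > 0` such that the `t`-fold sumset `N + ⋯ + N` has
exactly one element; it is `⊤ = ∞` if there is no such `t`, that is, if `N` is not nilpotent. -/
noncomputable def nilpotencyIndex (N : Type*) [AddCommSemigroup N] : ℕ∞ :=
  sInf ((fun t : ℕ => (t : ℕ∞)) '' {t : ℕ | 0 < t ∧ (foldSumset N t).ncard = 1})

end ArchSemigroup

/-!
The kernel `K` of a finite archimedean semigroup `S` is a group, with identity the idempotent `e`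
of `S`, and `a ↦ e + a` is a retraction of `S` onto `K` (`exists_kernelRetraction`). Two facts make
the group theory usable in `S`. First, the sum of a reducible sequence lies in `K`
(`inKernel_of_reducible`), because `s + c = s` forces `s ∈ K`. Second, if `σ(B) ∈ K` and the terms
of `C` project to a zero-sum sequence over `K`, then `σ(B + C) = σ(B)` (`InKernel.sameSum_add`). So
from a sequence `A` it suffices to remove `κ(S)` terms with zero-sum projection in such a way that
the rest has its sum in `K`.

Such terms are found by Gao's theorem: if `k ≥ |G|` is a multiple of the exponent of a finite
abelian group `G`, every sequence of length at least `k + D(G) - 1` has a zero-sum subsequence of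
length `k` (`IsDavenportBound.exists_zero_sum_card_eq`). After a translation, `0` has the largest
multiplicity `h` in the sequence. The nonzero terms contain a zero-sum subsequence of length at
least `k - h`; as long as it is longer than `k`, a zero-sum subsequence of length at most `h` can
be deleted from it, and in the end it is completed by zeros. The short zero-sum subsequences come
from the Kemperman–Scherk bound `|A + B| ≥ |A| + |B| - 1`.

For the first inequality, the remaining `D(S)` terms form a reducible sequence, whose sum is in
`K`. For the second one, only `D(S) - 1` terms remain. If `S = K`, there is nothing to check.
Otherwise `S` has no identity and `D(S) - 1` still bounds the Davenport constant of `K`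
(`isDavenportBound_pred`), so one may put a term lying in `K` aside before applying Gao's theorem.
If no term of `A` is in `K`, then either `D(S) ≥ 4`, and three or more terms remain, whose sum is in
`K` by nilpotency; or `D(S) = 3`, and then `3c = 2c ∈ K` for all `c ∉ K`. In the latter case all
terms project to `0`, and some `c` occurs twice in `A` since `|A| > |S|`: keep `c, c`.
-/

namespace ArchSemigroup

/-! ### Zero-sum subsequences of prescribed length in finite abelian groups -/

section Group

open scoped Pointwise

variable {G : Type*} [AddCommGroup G]

/-- Kemperman–Scherk bound: if `0 = a + b` has only the trivial solution in `A × B`, then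
`|A + B| ≥ |A| + |B| - 1`. Induction on `|B|` by the Dyson transform
`(A ∪ (B + e), B ∩ (A - e))` with `e ∈ A`, which preserves the hypotheses. -/
theorem card_add_card_le_card_add [DecidableEq G] (A B : Finset G) (hA : 0 ∈ A) (hB : 0 ∈ B)
    (h : ∀ a ∈ A, ∀ b ∈ B, a + b = 0 → a = 0) : A.card + B.card ≤ (A + B).card + 1 := by
  induction hn : B.card using Nat.strong_induction_on generalizing A B with
  | _ n ih =>
  subst hn
  by_cases H : ∃ e ∈ A, ∃ b ∈ B, b + e ∉ A
  · obtain ⟨e, he, b, hb, hbe⟩ := H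
    have hinter : A ∩ B.image (· + e) = (B.filter (· + e ∈ A)).image (· + e) := by
      ext x
      simp only [Finset.mem_inter, Finset.mem_image, Finset.mem_filter]
      constructor
      · rintro ⟨hx, y, hy, rfl⟩
        exact ⟨y, ⟨hy, hx⟩, rfl⟩
      · rintro ⟨y, ⟨hy, hx⟩, rfl⟩
        exact ⟨hx, y, hy, rfl⟩
    have hcard := Finset.card_union_add_card_inter A (B.image (· + e))
    rw [hinter, Finset.card_image_of_injective _ (add_left_injective e),
      Finset.card_image_of_injective _ (add_left_injective e)] at hcard
    have hlt : (B.filter (· + e ∈ A)).card < B.card :=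
      Finset.card_lt_card (Finset.filter_ssubset.2 ⟨b, hb, hbe⟩)
    have key := ih _ hlt (A ∪ B.image (· + e)) (B.filter (· + e ∈ A))
      (Finset.mem_union_left _ hA) (by simp [hB, he]) (by
        intro a ha c hc hac
        simp only [Finset.mem_union, Finset.mem_image, Finset.mem_filter] at ha hc
        rcases ha with ha | ⟨y, hy, rfl⟩
        · exact h a ha c hc.1 hac
        · -- the relation `(y + e) + c = 0` is `(c + e) + y = 0` with `c + e ∈ A` and `y ∈ B`
          have h1 : c + e = 0 := h _ hc.2 y hy (by rw [← hac]; abel)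
          have h2 : e = 0 := h e he c hc.1 (by rw [← h1]; abel)
          have h3 : c = 0 := by simpa [h2] using h1
          simpa [h3] using hac) rfl
    have hsub : A ∪ B.image (· + e) + B.filter (· + e ∈ A) ⊆ A + B := by
      intro x hx
      obtain ⟨a, ha, c, hc, rfl⟩ := Finset.mem_add.1 hx
      simp only [Finset.mem_union, Finset.mem_image, Finset.mem_filter] at ha hc
      rcases ha with ha | ⟨y, hy, rfl⟩
      · exact Finset.add_mem_add ha hc.1
      · exact Finset.mem_add.2 ⟨c + e, hc.2, y, hy, by abel⟩
    have := Finset.card_le_card hsub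
    omega
  · push Not at H
    have hB0 : B ⊆ {0} := by
      intro b hb
      have himg : A.image (· + b) = A := Finset.eq_of_subset_of_card_le
        (by
          intro x hx
          obtain ⟨a, ha, rfl⟩ := Finset.mem_image.1 hx
          simpa [add_comm] using H a ha b hb)
        (by rw [Finset.card_image_of_injective _ (add_left_injective b)])
      rw [← himg] at hA
      obtain ⟨a, ha, hab⟩ := Finset.mem_image.1 hA
      have ha0 := h a ha b hb hab
      simpa [ha0] using hab
    have h1 := Finset.card_le_card hB0
    have h2 : A ⊆ A + B := fun a ha => Finset.mem_add.2 ⟨a, ha, 0, hB, add_zero a⟩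
    have h3 := Finset.card_le_card h2
    simp at h1
    omega

/-- Peel off the distinct terms of `V`, `h` times, and bound the set of sums from below with the
Kemperman–Scherk inequality at each step. -/
theorem exists_finset_sums_of_no_short_zero_sum [DecidableEq G] (h : ℕ) (V : Multiset G)
    (hcount : ∀ g, V.count g ≤ h)
    (hV : ∀ Y ≤ V, Y.card ≤ h → Y.sum = 0 → Y = 0) :
    ∃ P : Finset G, 0 ∈ P ∧ V.card + 1 ≤ P.card ∧
      ∀ p ∈ P, ∃ Y ≤ V, Y.card ≤ h ∧ Y.sum = p := by
  induction h generalizing V with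
  | zero =>
    have : V = 0 := Multiset.eq_zero_of_forall_notMem fun g hg => by
      have := Multiset.count_pos.2 hg
      have := hcount g
      omega
    subst this
    exact ⟨{0}, by simp, by simp, by simp⟩
  | succ h ih =>
    have hle : V.dedup ≤ V := Multiset.dedup_le V
    have hsplit : V - V.dedup + V.dedup = V := tsub_add_cancel_of_le hle
    obtain ⟨P, hP0, hPcard, hP⟩ := ih (V - V.dedup)
      (fun g => by
        have := hcount g
        rw [Multiset.count_sub, Multiset.count_dedup]
        split_ifs with hg
        · omega
        · rw [Multiset.count_eq_zero_of_notMem hg]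
          omega)
      (fun Y hY hc hs => hV Y (hY.trans tsub_le_self) (by omega) hs)
    -- `0` is not a term, so the distinct terms together with `0` form a set with
    -- one more element
    have h0 : (0 : G) ∉ V := fun h0 => by
      have := hV {0} (by simpa using h0) (by simp) (by simp)
      simp at this
    have hext : ∀ p ∈ P, ∀ b ∈ insert 0 V.toFinset,
        ∃ Y ≤ V, Y.card ≤ h + 1 ∧ Y.sum = p + b ∧ (b ≠ 0 → Y ≠ 0) := by
      intro p hp b hb
      obtain ⟨Y, hY, hc, rfl⟩ := hP p hp
      rcases Finset.mem_insert.1 hb with rfl | hb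
      · exact ⟨Y, hY.trans tsub_le_self, by omega, by simp, by simp⟩
      · refine ⟨Y + {b}, ?_, by simpa using hc, by simp, by simp⟩
        rw [← hsplit]
        exact add_le_add hY (by simpa using hb)
    refine ⟨P + insert 0 V.toFinset, ?_, ?_, ?_⟩
    · exact Finset.mem_add.2 ⟨0, hP0, 0, by simp, by simp⟩
    · have key := card_add_card_le_card_add P (insert 0 V.toFinset) hP0 (by simp) (by
        intro p hp b hb hpb
        obtain ⟨Y, hY, hc, hs, hne⟩ := hext p hp b hb
        have hY0 := hV Y hY hc (hs.trans hpb)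
        have hb0 : b = 0 := by
          by_contra hb0
          exact hne hb0 hY0
        simpa [hb0] using hpb)
      have hcard := congrArg Multiset.card hsplit
      rw [Multiset.card_add] at hcard
      rw [Finset.card_insert_of_notMem (by simpa using h0)] at key
      have : V.toFinset.card = V.dedup.card := rfl
      omega
    · intro x hx
      obtain ⟨p, hp, b, hb, rfl⟩ := Finset.mem_add.1 hx
      obtain ⟨Y, hY, hc, hs, -⟩ := hext p hp b hb
      exact ⟨Y, hY, hc, hs⟩

theorem exists_short_zero_sum [Fintype G] [DecidableEq G] (h : ℕ) (V : Multiset G)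
    (hcount : ∀ g, V.count g ≤ h) (hcard : Fintype.card G ≤ V.card) :
    ∃ Y ≤ V, Y ≠ 0 ∧ Y.card ≤ h ∧ Y.sum = 0 := by
  by_contra! H
  obtain ⟨P, -, hP, -⟩ := exists_finset_sums_of_no_short_zero_sum h V hcount
    (fun Y hY hc hs => by
      by_contra hne
      exact H Y hY hne hc hs)
  have := Finset.card_le_univ P
  omega

/-- Every sequence over `G` of length at least `D` has a nonempty zero-sum subsequence; that is, `D`
is at least the Davenport constant of the group `G`. -/
def IsDavenportBound (G : Type*) [AddCommGroup G] (D : ℕ) : Prop :=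
  ∀ X : Multiset G, D ≤ X.card → ∃ Y ≤ X, Y ≠ 0 ∧ Y.sum = 0

theorem IsDavenportBound.exists_zero_sum_card_sub_lt [DecidableEq G] {D : ℕ}
    (hD : IsDavenportBound G D) (T : Multiset G) :
    ∃ V ≤ T, V.sum = 0 ∧ T.card < V.card + D := by
  induction hn : T.card using Nat.strong_induction_on generalizing T with
  | _ n ih =>
  subst hn
  by_cases hT : T.card < D
  · exact ⟨0, Multiset.zero_le T, by simp, by simpa using hT⟩
  · obtain ⟨Y, hY, hY0, hYs⟩ := hD T (by omega)
    have hc := Multiset.card_sub hY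
    have hYc := Multiset.card_le_card hY
    have hYp := Multiset.card_pos.2 hY0
    obtain ⟨V, hV, hVs, hVc⟩ := ih (T - Y).card (by omega) (T - Y) rfl
    refine ⟨Y + V, ?_, by simp [hYs, hVs], ?_⟩
    · rw [← add_tsub_cancel_of_le hY]
      exact add_le_add_right hV Y
    · rw [Multiset.card_add]
      omega

/-- A long zero-sum sequence shrinks by at most `h` at a time, so its length can be brought into
the interval `[k - h, k]`. -/
theorem exists_zero_sum_card_mem_Icc [Fintype G] [DecidableEq G] {k h : ℕ}
    (hk : Fintype.card G ≤ k) (V : Multiset G) (hcount : ∀ g, V.count g ≤ h) (hs : V.sum = 0)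
    (hV : k ≤ V.card + h) :
    ∃ U ≤ V, U.sum = 0 ∧ k ≤ U.card + h ∧ U.card ≤ k := by
  induction hn : V.card using Nat.strong_induction_on generalizing V with
  | _ n ih =>
  subst hn
  by_cases hVk : V.card ≤ k
  · exact ⟨V, le_rfl, hs, hV, hVk⟩
  · obtain ⟨Y, hY, hY0, hYh, hYs⟩ := exists_short_zero_sum h V hcount (by omega)
    have hc := Multiset.card_sub hY
    have hYc := Multiset.card_le_card hY
    have hYp := Multiset.card_pos.2 hY0
    have hsum : (V - Y).sum = 0 := by
      have := congrArg Multiset.sum (add_tsub_cancel_of_le hY)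
      simpa [hYs, hs] using this
    obtain ⟨U, hU, h1, h2, h3⟩ := ih (V - Y).card (by omega) (V - Y)
      (fun g => (Multiset.count_le_of_le g tsub_le_self).trans (hcount g)) hsum (by omega) rfl
    exact ⟨U, hU.trans tsub_le_self, h1, h2, h3⟩

theorem IsDavenportBound.exists_zero_sum_card_eq_of_count_le [Fintype G] [DecidableEq G] {D k : ℕ}
    (hD : IsDavenportBound G D) (hk : Fintype.card G ≤ k) (W : Multiset G)
    (hmax : ∀ g, W.count g ≤ W.count 0) (hW : k + D ≤ W.card + 1) :
    ∃ Y ≤ W, Y.card = k ∧ Y.sum = 0 := by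
  have hsplit : Multiset.replicate (W.count 0) 0 + W.filter (¬ · = 0) = W := by
    rw [← Multiset.filter_eq', Multiset.filter_add_not]
  have hcard := congrArg Multiset.card hsplit
  rw [Multiset.card_add, Multiset.card_replicate] at hcard
  obtain ⟨V, hV, hVs, hVc⟩ := hD.exists_zero_sum_card_sub_lt (W.filter (¬ · = 0))
  have hcount : ∀ g, V.count g ≤ W.count 0 := fun g =>
    (Multiset.count_le_of_le g (hV.trans (Multiset.filter_le _ _))).trans (hmax g)
  obtain ⟨U, hU, hUs, hU1, hU2⟩ :=
    exists_zero_sum_card_mem_Icc hk V hcount hVs (by omega)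
  refine ⟨Multiset.replicate (k - U.card) 0 + U, ?_, ?_, by simp [hUs]⟩
  · conv_rhs => rw [← hsplit]
    exact add_le_add ((Multiset.replicate_le_replicate 0).2 (by omega)) (hU.trans hV)
  · rw [Multiset.card_add, Multiset.card_replicate]
    omega

theorem _root_.Multiset.exists_le_map_eq {α β : Type*} (f : α → β) {A : Multiset α}
    {Y : Multiset β} (hY : Y ≤ A.map f) : ∃ C ≤ A, C.map f = Y := by
  induction A, Y using Quotient.inductionOn₂ with
  | _ l m =>
  obtain ⟨l', hl', hs⟩ := (Multiset.coe_le.1 hY : List.Subperm m (l.map f))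
  obtain ⟨l'', h1, rfl⟩ := List.sublist_map_iff.1 hs
  exact ⟨l'', Multiset.coe_le.2 h1.subperm, Quot.sound hl'⟩

/-- Gao's theorem, with an arbitrary length `k ≥ |G|` annihilating `G` in place of `|G|`. -/
theorem IsDavenportBound.exists_zero_sum_card_eq [Fintype G] {D k : ℕ}
    (hD : IsDavenportBound G D) (hk : Fintype.card G ≤ k) (hexp : ∀ g : G, k • g = 0)
    (W : Multiset G) (hW : k + D ≤ W.card + 1) :
    ∃ Y ≤ W, Y.card = k ∧ Y.sum = 0 := by
  classical
  obtain ⟨g₀, hg₀⟩ := Finite.exists_max (fun g => W.count g)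
  obtain ⟨Y, hY, hYc, hYs⟩ := hD.exists_zero_sum_card_eq_of_count_le hk (W.map (· - g₀))
    (fun g => by
      have hcount : ∀ g, (W.map (· - g₀)).count (g - g₀) = W.count g := fun g =>
        Multiset.count_map_eq_count' _ _ (sub_left_injective (b := g₀)) g
      have h1 := hcount (g + g₀)
      have h2 := hcount g₀
      rw [add_sub_cancel_right] at h1
      rw [sub_self] at h2
      rw [h1, h2]
      exact hg₀ _) (by simpa using hW)
  obtain ⟨C, hC, rfl⟩ := Multiset.exists_le_map_eq _ hY
  rw [Multiset.card_map] at hYc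
  refine ⟨C, hC, hYc, ?_⟩
  simpa [Multiset.sum_map_sub, hYc, hexp] using hYs

end Group
/-! ### Sums of sequences over a commutative semigroup -/

section Sums

variable {S : Type*} [AddCommSemigroup S]

theorem IsIdentity.eq {z w : S} (hz : IsIdentity z) (hw : IsIdentity w) : z = w := by
  rw [← hw z, add_comm, hz]

theorem SumsTo.unique {A : Multiset S} {s t : S} (hs : SumsTo A s) (ht : SumsTo A t) : s = t := by
  rcases hs with hs | ⟨rfl, hs⟩
  · rcases ht with ht | ⟨rfl, -⟩
    · exact WithZero.coe_inj.1 (hs.symm.trans ht)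
    · simp at hs
  · rcases ht with ht | ⟨-, ht⟩
    · simp at ht
    · exact hs.eq ht

theorem sumsTo_singleton (a : S) : SumsTo {a} a := Or.inl (by simp)

theorem SumsTo.map {T : Type*} [AddCommSemigroup T] (f : S →ₙ+ T) {A : Multiset S} {s : S}
    (hA : A ≠ 0) (h : SumsTo A s) : SumsTo (A.map f) (f s) := by
  obtain h | ⟨h, -⟩ := h
  · have := congrArg (WithZero.lift ((WithZero.coeAddHom (α := T)).comp f)) h
    rw [map_multiset_sum] at this
    left
    simpa [Multiset.map_map, Function.comp_def] using this
  · exact absurd h hA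

end Sums

/-! ### Retraction onto a kernel that is a group -/

/-- The kernel of `S` is a copy of the abelian group `G`: `incl` embeds `G` onto the kernel and
`proj` is the retraction `a ↦ e + a`, where `e = incl 0`. The last field says that `s` lies in the
kernel as soon as some translation fixes it, which holds when `S` is archimedean. -/
structure KernelRetraction (S G : Type*) [AddCommSemigroup S] [AddCommGroup G] where
  proj : S →ₙ+ G
  incl : G →ₙ+ S
  proj_incl : ∀ g, proj (incl g) = g
  add_incl : ∀ a g, a + incl g = incl (proj a + g)
  incl_proj_of_add_eq : ∀ s c, s + c = s → incl (proj s) = s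

namespace KernelRetraction

variable {S G : Type*} [AddCommSemigroup S] [AddCommGroup G] (R : KernelRetraction S G)

/-- `a` lies in the image of `incl`, which is the kernel of `S` (`mem_kernel_iff`). -/
def InKernel (a : S) : Prop := R.incl (R.proj a) = a

theorem inKernel_incl (g : G) : R.InKernel (R.incl g) := by
  rw [InKernel, R.proj_incl]

theorem mem_kernel_iff (a : S) : a ∈ kernel S ↔ R.InKernel a := by
  constructor
  · intro h
    let I : AddSemigroupIdeal S :=
      { carrier := {a | R.InKernel a}
        vadd_mem' := fun c {a} ha => by
          have ha : R.incl (R.proj a) = a := ha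
          change R.InKernel (c + a)
          rw [← ha, R.add_incl]
          exact R.inKernel_incl _ }
    exact h I ⟨R.incl 0, R.inKernel_incl 0⟩
  · rintro h I ⟨b, hb⟩
    have := R.add_incl b (R.proj a - R.proj b)
    rw [add_sub_cancel, h, add_comm] at this
    rw [← this]
    exact AddSemigroupIdeal.add_mem I _ hb

theorem sum_map_proj {A : Multiset S} {s : S} (h : SumsTo A s) :
    (A.map R.proj).sum = R.proj s := by
  rcases h with h | ⟨rfl, h⟩
  · have := congrArg (WithZero.lift R.proj) h
    rw [map_multiset_sum] at this
    simpa [Multiset.map_map, Function.comp_def] using this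
  · have := congrArg R.proj (h s)
    rw [map_add] at this
    simpa using (add_eq_right.1 this).symm

/-- Adding a sequence to an element of the kernel only depends on its projection. The sequence may
be empty, hence the computation in `WithZero S`. -/
theorem coe_incl_add_sum (g : G) (C : Multiset S) :
    ((R.incl g : S) : WithZero S) + (C.map (fun a : S => (a : WithZero S))).sum
      = ((R.incl (g + (C.map R.proj).sum) : S) : WithZero S) := by
  induction C using Multiset.induction generalizing g with
  | empty => simp
  | cons a C ih =>
    rw [Multiset.map_cons, Multiset.sum_cons, ← add_assoc, ← WithZero.coe_add, add_comm (R.incl g),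
      R.add_incl, ih, Multiset.map_cons, Multiset.sum_cons]
    congr 2
    abel

theorem InKernel.of_le {R : KernelRetraction S G} {A B : Multiset S} {s t : S} (hs : R.InKernel s)
    (hBA : B ≤ A) (hB0 : B ≠ 0) (hB : SumsTo B s) (hA : SumsTo A t) : R.InKernel t := by
  obtain ⟨C, rfl⟩ := Multiset.le_iff_exists_add.1 hBA
  have hB : (B.map (fun a : S => (a : WithZero S))).sum = s := by
    rcases hB with hB | ⟨hB, -⟩
    · exact hB
    · exact absurd hB hB0
  have hBC : SumsTo (B + C) (R.incl (R.proj s + (C.map R.proj).sum)) := by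
    left
    rw [Multiset.map_add, Multiset.sum_add, hB, ← R.coe_incl_add_sum, hs]
  rw [hA.unique hBC]
  exact R.inKernel_incl _

theorem InKernel.of_mem {R : KernelRetraction S G} {A : Multiset S} {g s : S} (hg : R.InKernel g)
    (hgA : g ∈ A) (hA : SumsTo A s) : R.InKernel s :=
  hg.of_le (Multiset.singleton_le.2 hgA) (by simp) (sumsTo_singleton g) hA

theorem InKernel.sameSum_add {R : KernelRetraction S G} {B C : Multiset S} {s : S}
    (hs : R.InKernel s) (hB : SumsTo B s) (hC : (C.map R.proj).sum = 0) : SameSum B (B + C) := by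
  refine ⟨s, hB, ?_⟩
  rcases hB with hB | ⟨rfl, hid⟩
  · left
    rw [Multiset.map_add, Multiset.sum_add, hB, ← hs, R.coe_incl_add_sum, hC, add_zero]
  · rw [zero_add]
    by_cases hC0 : C = 0
    · exact Or.inr ⟨hC0, hid⟩
    · obtain ⟨u, hu⟩ := exists_sumsTo C hC0
      rw [R.sum_map_proj hu] at hC
      have h1 := R.add_incl u (R.proj s)
      rw [hC, zero_add, hs, add_comm, hid] at h1
      exact h1 ▸ hu

/-- If a proper subsequence has the same sum `s`, the deleted terms fix `s` by translation. When the
subsequence is empty, `s` is an identity and fixes itself. -/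
theorem inKernel_of_reducible {A : Multiset S} {s : S} (hA : Reducible A) (hs : SumsTo A s) :
    R.InKernel s := by
  obtain ⟨B, hBA, t, hB, hA⟩ := hA
  obtain rfl := hs.unique hA
  obtain ⟨C, rfl⟩ := Multiset.le_iff_exists_add.1 hBA.le
  have hC0 : C ≠ 0 := by
    rintro rfl
    simp at hBA
  rcases hB with hB | ⟨-, hid⟩
  · obtain ⟨u, hu⟩ := exists_sumsTo C hC0
    refine R.incl_proj_of_add_eq s u ?_
    obtain hu | ⟨hu, -⟩ := hu
    · obtain hA | ⟨hA, -⟩ := hA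
      · rw [Multiset.map_add, Multiset.sum_add, hB, hu, ← WithZero.coe_add] at hA
        exact WithZero.coe_inj.1 hA
      · exact absurd (add_eq_zero.1 hA).2 hC0
    · exact absurd hu hC0
  · exact R.incl_proj_of_add_eq s s (hid s)

theorem sum_map_proj_eq_zero_of_sameSum_add {B C : Multiset S} (h : SameSum B (B + C)) :
    (C.map R.proj).sum = 0 := by
  obtain ⟨s, hB, hBC⟩ := h
  have h1 := R.sum_map_proj hBC
  rw [Multiset.map_add, Multiset.sum_add, R.sum_map_proj hB] at h1
  exact add_eq_left.1 h1

theorem isDavenportBound (R : KernelRetraction S G) {D : ℕ}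
    (hD : ∀ A : Multiset S, D ≤ A.card → Reducible A) :
    IsDavenportBound G D := by
  intro X hX
  obtain ⟨B, hB, hs⟩ := hD (X.map R.incl) (by simpa using hX)
  obtain ⟨C, hC⟩ := Multiset.le_iff_exists_add.1 hB.le
  rw [hC] at hs hB
  refine ⟨C.map R.proj, ?_, ?_, R.sum_map_proj_eq_zero_of_sameSum_add hs⟩
  · have := Multiset.map_le_map (f := R.proj) (hC ▸ Multiset.le_add_left C B)
    simpa [Multiset.map_map, Function.comp_def, R.proj_incl] using this
  · simp only [ne_eq, Multiset.map_eq_zero]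
    rintro rfl
    simp at hB

/-- The empty sequence has a sum only if `S` has an identity, and then `S` is its own kernel. -/
theorem ne_zero_of_sumsTo {c : S} (hc : ¬ R.InKernel c) {A : Multiset S} {s : S}
    (h : SumsTo A s) : A ≠ 0 := by
  rintro rfl
  rcases h with h | ⟨-, h⟩
  · simp at h
  · exact hc (R.incl_proj_of_add_eq c s (by rw [add_comm, h]))

/-- If `S` is not a group, the Davenport constant of `S` exceeds that of its kernel. A zero-sum free
sequence `X` would extend to the zero-sum sequence `-σ(X), X`; it is reducible, and since `S` has no
identity this splits it into two nonempty zero-sum parts, one of which is contained in `X`. -/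
theorem isDavenportBound_pred (R : KernelRetraction S G) {c : S} (hc : ¬ R.InKernel c) {D : ℕ}
    (hD : ∀ A : Multiset S, D ≤ A.card → Reducible A) : IsDavenportBound G (D - 1) := by
  intro X hX
  obtain ⟨B, hB, hs⟩ := hD ((-X.sum ::ₘ X).map R.incl) (by simp; omega)
  obtain ⟨Y, hY, rfl⟩ := Multiset.exists_le_map_eq _ hB.le
  have hYX : Y ≠ -X.sum ::ₘ X := by
    rintro rfl
    exact hB.ne rfl
  obtain ⟨s, hYs, hXs⟩ := hs
  have hY0 : Y ≠ 0 := by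
    simpa using R.ne_zero_of_sumsTo hc hYs
  have hYsum : Y.sum = 0 := by
    have h1 := (R.sum_map_proj hYs).trans (R.sum_map_proj hXs).symm
    simpa [Multiset.map_map, Function.comp_def, R.proj_incl] using h1
  by_cases hle : Y ≤ X
  · exact ⟨Y, hle, hY0, hYsum⟩
  · have hmem : -X.sum ∈ Y := by
      by_contra hmem
      exact hle ((Multiset.le_cons_of_notMem hmem).1 hY)
    obtain ⟨Z, rfl⟩ := Multiset.exists_cons_of_mem hmem
    have hZ := (Multiset.cons_le_cons_iff _).1 hY
    obtain ⟨V, hV⟩ := Multiset.le_iff_exists_add.1 hZ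
    refine ⟨V, hV ▸ Multiset.le_add_left V Z, ?_, ?_⟩
    · rintro rfl
      rw [add_zero] at hV
      exact hYX (by rw [← hV])
    · have h1 := congrArg Multiset.sum hV
      rw [Multiset.sum_add] at h1
      rw [Multiset.sum_cons, neg_add_eq_zero] at hYsum
      rw [hYsum] at h1
      exact left_eq_add.1 h1

/-- For `c` outside the kernel, a relation `mc = nc` with `m < n` requires `m ≥ 2`. -/
theorem exists_sumsTo_replicate {c : S} (hc : ¬ R.InKernel c) {n : ℕ}
    (h : Reducible (Multiset.replicate n c)) :
    ∃ m s, 2 ≤ m ∧ m < n ∧ R.InKernel s ∧ SumsTo (Multiset.replicate m c) s ∧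
      SumsTo (Multiset.replicate n c) s := by
  obtain ⟨B, hB, s, hBs, hs⟩ := id h
  have hker := R.inKernel_of_reducible h hs
  obtain ⟨m, hm, rfl⟩ := Multiset.le_replicate_iff.1 hB.le
  refine ⟨m, s, ?_, ?_, hker, hBs, hs⟩
  · by_contra hlt
    have h0 := R.ne_zero_of_sumsTo hc hBs
    obtain rfl | rfl : m = 0 ∨ m = 1 := by omega
    · simp at h0
    · rw [Multiset.replicate_one] at hBs
      rw [hBs.unique (sumsTo_singleton c)] at hker
      exact hc hker
  · simpa using Multiset.card_lt_card hB

end KernelRetraction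

/-! ### Structure and invariants of finite archimedean semigroups -/

section Structure

universe u

variable {S : Type u} [AddCommSemigroup S]

/-- The elements for which `e` acts as an identity; for an idempotent `e` this is `e + S`. -/
def localSubsemigroup (e : S) : AddSubsemigroup S where
  carrier := {a | e + a = a}
  add_mem' := fun {a b} (ha : e + a = a) _ => by
    change e + (a + b) = a + b
    rw [← add_assoc, ha]

/-- The group structure on `e + S` when `e` is an idempotent divisible by every element of `S`; the
inverse of `a` is `e + y`, where `a + y = e`. -/
@[reducible]
noncomputable def localAddCommGroup {e : S} (he : e + e = e) (hinv : ∀ b, ∃ y, b + y = e) :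
    AddCommGroup (localSubsemigroup e) :=
  letI : Zero (localSubsemigroup e) := ⟨⟨e, he⟩⟩
  letI : Neg (localSubsemigroup e) := ⟨fun a => ⟨e + (hinv a).choose, by
    change e + (e + _) = e + _
    rw [← add_assoc, he]⟩⟩
  { AddGroup.ofLeftAxioms (G := localSubsemigroup e) add_assoc (fun a => Subtype.ext a.2)
      fun a => Subtype.ext (by
        change e + (hinv a).choose + a = e
        rw [add_assoc, add_comm _ (a : S), (hinv a).choose_spec, he]) with
    add_comm := add_comm }

theorem exists_kernelRetraction [Finite S] [Nonempty S] (hS : IsArchimedean S) :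
    ∃ (G : Type u) (_ : AddCommGroup G), Nonempty (KernelRetraction S G) := by
  obtain ⟨e, he⟩ : ∃ e : S, e + e = e := by
    let : TopologicalSpace S := ⊥
    have : DiscreteTopology S := ⟨rfl⟩
    exact exists_idempotent_of_compact_t2_of_continuous_add_left
      fun _ => continuous_of_discreteTopology
  have hinv : ∀ b, ∃ y, b + y = e := by
    intro b
    obtain ⟨m, -, hm, -, x, -, hx, -⟩ := hS e b
    have hme : ∀ m : ℕ, (m + 1) • (e : WithZero S) = e := by
      intro m
      induction m with
      | zero => simp
      | succ m ih => rw [succ_nsmul, ih, ← WithZero.coe_add, he]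
    obtain ⟨m, rfl⟩ := Nat.exists_eq_add_of_lt hm
    rw [zero_add, hme] at hx
    exact ⟨x, (WithZero.coe_inj.1 hx).symm⟩
  let := localAddCommGroup he hinv
  refine ⟨localSubsemigroup e, inferInstance, ⟨{
    proj := ⟨fun a => ⟨e + a, by
      change e + (e + a) = e + a
      rw [← add_assoc, he]⟩, fun a b => Subtype.ext ?_⟩
    incl := ⟨Subtype.val, fun _ _ => rfl⟩
    proj_incl := fun g => Subtype.ext g.2
    add_incl := fun a g => ?_
    incl_proj_of_add_eq := fun s c hsc => ?_ }⟩⟩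
  · change e + (a + b) = e + a + (e + b)
    rw [add_add_add_comm, he]
  · change a + g = e + a + g
    rw [add_comm e, add_assoc, g.2]
  · obtain ⟨m, -, -, -, x, -, hx, -⟩ := hS c e
    have hm : ∀ m : ℕ, (s : WithZero S) + m • (c : WithZero S) = s := by
      intro m
      induction m with
      | zero => simp
      | succ m ih => rw [succ_nsmul, ← add_assoc, ih, ← WithZero.coe_add, hsc]
    have h1 := hm m
    rw [hx, ← WithZero.coe_add, WithZero.coe_inj] at h1
    change e + s = s
    rw [← h1, add_left_comm, ← add_assoc e e, he]

theorem period_spec [Finite S] (a : S) : 0 < period a ∧ ∃ r : ℕ, 0 < r ∧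
    r • (a : WithZero S) = (r + period a) • (a : WithZero S) := by
  refine Nat.sInf_mem (s := {t : ℕ | 0 < t ∧ ∃ r : ℕ, 0 < r ∧
    r • (a : WithZero S) = (r + t) • (a : WithZero S)}) ?_
  have : Finite (WithZero S) := inferInstanceAs (Finite (Option S))
  obtain ⟨i, j, hij, h⟩ := Finite.exists_ne_map_eq_of_infinite
    fun n : ℕ => (n + 1) • (a : WithZero S)
  wlog hlt : i < j generalizing i j
  · exact this j i hij.symm h.symm (by omega)
  refine ⟨j - i, by omega, i + 1, by omega, ?_⟩
  rw [show i + 1 + (j - i) = j + 1 by omega]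
  exact h

theorem exponent_pos (S : Type*) [AddCommSemigroup S] [Fintype S] : 0 < exponent S := by
  refine Nat.pos_of_ne_zero fun h => ?_
  obtain ⟨a, -, ha⟩ := Finset.lcm_eq_zero_iff.1 h
  exact (period_spec a).1.ne' ha

theorem card_le_kappa (S : Type*) [AddCommSemigroup S] [Fintype S] :
    Fintype.card S ≤ kappa S := by
  have hpos : (0 : ℚ) < exponent S := by exact_mod_cast exponent_pos S
  have h := Nat.le_ceil ((Fintype.card S : ℚ) / (exponent S : ℚ))
  rw [div_le_iff₀ hpos] at h
  exact_mod_cast h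

theorem KernelRetraction.kappa_nsmul [Fintype S] {G : Type*} [AddCommGroup G]
    (R : KernelRetraction S G) (g : G) : kappa S • g = 0 := by
  obtain ⟨-, r, -, hr⟩ := period_spec (R.incl g)
  have h1 := congrArg (WithZero.lift R.proj) hr
  simp only [map_nsmul, WithZero.lift_coe, R.proj_incl] at h1
  rw [add_nsmul] at h1
  have h2 : period (R.incl g) ∣ kappa S :=
    (Finset.dvd_lcm (Finset.mem_univ _)).trans (Dvd.intro_left _ rfl)
  obtain ⟨q, hq⟩ := h2
  have h3 : period (R.incl g) • g = 0 := left_eq_add.1 h1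
  rw [hq, mul_nsmul, h3, nsmul_zero]

/-- Gao's theorem applied to the projection of a sequence over `S`; it applies since `κ(S) ≥ |S|`
and the exponent of the kernel divides `κ(S)`. -/
theorem KernelRetraction.exists_le_card_eq_kappa [Fintype S] {G : Type*} [AddCommGroup G]
    (R : KernelRetraction S G) {D : ℕ} (hD : IsDavenportBound G D) (A : Multiset S)
    (hA : kappa S + D ≤ A.card + 1) :
    ∃ C ≤ A, C.card = kappa S ∧ (C.map R.proj).sum = 0 := by
  classical
  have hinj : Function.Injective R.incl := Function.LeftInverse.injective R.proj_incl
  have : Fintype G := Fintype.ofInjective _ hinj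
  obtain ⟨Y, hY, hYc, hYs⟩ := hD.exists_zero_sum_card_eq
    ((Fintype.card_le_of_injective _ hinj).trans (card_le_kappa S)) R.kappa_nsmul
    (A.map R.proj) (by simpa using hA)
  obtain ⟨C, hC, rfl⟩ := Multiset.exists_le_map_eq _ hY
  exact ⟨C, hC, by simpa using hYc, hYs⟩

theorem KernelRetraction.inKernel_of_three_le_card {G : Type*} [AddCommGroup G]
    (R : KernelRetraction S G) (h : nilpotencyIndex (ReesQuotient (kernel S)) ≤ 3)
    {A : Multiset S} {s : S} (hA : 3 ≤ A.card) (hs : SumsTo A s) : R.InKernel s := by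
  set T := (fun t : ℕ => (t : ℕ∞)) '' {t : ℕ | 0 < t ∧
    (foldSumset (ReesQuotient (kernel S)) t).ncard = 1} with hT
  have hne : T.Nonempty := by
    by_contra hne
    rw [Set.not_nonempty_iff_eq_empty] at hne
    rw [nilpotencyIndex, ← hT, hne, sInf_empty] at h
    exact absurd h (by decide)
  obtain ⟨t, ⟨ht0, ht⟩, htn⟩ := csInf_mem hne
  have ht3 : t ≤ 3 := by
    have h3 : (t : ℕ∞) ≤ 3 := htn.trans_le h
    exact_mod_cast h3
  let q : S →ₙ+ ReesQuotient (kernel S) := ⟨fun a => (a : (reesCon (kernel S)).Quotient),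
    fun _ _ => rfl⟩
  have hmem : ∀ (B : Multiset S) (b : S), B.card = t → SumsTo B b →
      q b ∈ foldSumset (ReesQuotient (kernel S)) t := fun B b hB hb =>
    ⟨B.map q, by simpa using hB, hb.map q (Multiset.card_pos.1 (by omega))⟩
  have h0 : Multiset.replicate t (R.incl 0) ≠ 0 := Multiset.card_pos.1 (by simpa using ht0)
  obtain ⟨z, hz⟩ := exists_sumsTo _ h0
  have hzK : R.InKernel z :=
    (R.inKernel_incl 0).of_mem (Multiset.mem_replicate.2 ⟨by omega, rfl⟩) hz
  obtain ⟨B, hBA, hBt⟩ : ∃ B ≤ A, B.card = t := by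
    have hpos : 0 < (Multiset.powersetCard t A).card := by
      rw [Multiset.card_powersetCard]
      exact Nat.choose_pos (by omega)
    obtain ⟨B, hB⟩ := Multiset.card_pos_iff_exists_mem.1 hpos
    exact ⟨B, Multiset.mem_powersetCard.1 hB⟩
  have hB0 : B ≠ 0 := Multiset.card_pos.1 (by omega)
  obtain ⟨b, hb⟩ := exists_sumsTo B hB0
  have hbz : q b = q z := by
    obtain ⟨w, hw⟩ := Set.ncard_eq_one.1 ht
    have h1 := hmem B b hBt hb
    have h2 := hmem _ z (by simp) hz
    rw [hw, Set.mem_singleton_iff] at h1 h2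
    rw [h1, h2]
  have hbK : R.InKernel b := by
    rcases (AddCon.eq (reesCon (kernel S))).1 hbz with rfl | hbz
    · exact hzK
    · exact (R.mem_kernel_iff b).1 hbz.1
  exact hbK.of_le hBA hB0 hb hs

/-! ### Deleting subsequences of length `κ(S)` -/

theorem exists_davenport_eq (S : Type*) [AddCommSemigroup S] [Finite S] :
    ∃ D : ℕ, 0 < D ∧ davenport S = D ∧ ∀ A : Multiset S, D ≤ A.card → Reducible A := by
  have hne : ((fun l : ℕ => (l : ℕ∞)) ''
      {l : ℕ | 0 < l ∧ ∀ A : Multiset S, l ≤ A.card → Reducible A}).Nonempty := by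
    by_contra hne
    rw [Set.not_nonempty_iff_eq_empty] at hne
    exact davenport_ne_top S (by rw [davenport, hne, sInf_empty])
  obtain ⟨D, ⟨h0, hD⟩, h⟩ := csInf_mem hne
  exact ⟨D, h0, h.symm, hD⟩

theorem KernelRetraction.exists_subsequence_of_zero_sum [Fintype S] {G : Type*} [AddCommGroup G]
    (R : KernelRetraction S G) {A C : Multiset S} (hCA : C ≤ A) (hC : C.card = kappa S)
    (hs : (C.map R.proj).sum = 0) (hB : ∀ B, B + C = A → ∃ s, SumsTo B s ∧ R.InKernel s) :
    ∃ B : Multiset S, B ≤ A ∧ SameSum B A ∧ A.card = B.card + kappa S := by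
  classical
  have hBC : A - C + C = A := tsub_add_cancel_of_le hCA
  obtain ⟨s, hsB, hsK⟩ := hB _ hBC
  refine ⟨A - C, tsub_le_self, ?_, ?_⟩
  · have := hsK.sameSum_add hsB hs
    rwa [hBC] at this
  · rw [← hC, ← Multiset.card_add, hBC]

theorem KernelRetraction.exists_subsequence_of_card_eq [Fintype S] {G : Type*} [AddCommGroup G]
    (R : KernelRetraction S G) {D : ℕ} (hD0 : 0 < D)
    (hD : ∀ A : Multiset S, D ≤ A.card → Reducible A) (A : Multiset S)
    (hA : A.card = D + kappa S) :
    ∃ B : Multiset S, B ≤ A ∧ SameSum B A ∧ A.card = B.card + kappa S := by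
  obtain ⟨C, hCA, hC, hs⟩ := R.exists_le_card_eq_kappa (R.isDavenportBound hD) A (by omega)
  refine R.exists_subsequence_of_zero_sum hCA hC hs fun B hB => ?_
  have hBc : B.card = D := by
    have := congrArg Multiset.card hB
    rw [Multiset.card_add] at this
    omega
  obtain ⟨s, hsB⟩ := exists_sumsTo B (Multiset.card_pos.1 (by omega))
  exact ⟨s, hsB, R.inKernel_of_reducible (hD B hBc.ge) hsB⟩

theorem KernelRetraction.exists_subsequence_of_card_add_one_eq [Fintype S] {G : Type*}
    [AddCommGroup G] (R : KernelRetraction S G)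
    (hnil : nilpotencyIndex (ReesQuotient (kernel S)) ≤ 3) {D : ℕ}
    (hD : ∀ A : Multiset S, D ≤ A.card → Reducible A) (A : Multiset S)
    (hA : A.card + 1 = D + kappa S) :
    ∃ B : Multiset S, B ≤ A ∧ SameSum B A ∧ A.card = B.card + kappa S := by
  classical
  -- the remaining sequence may be empty here, when `D = 1`
  by_cases hK : ∀ c, R.InKernel c
  · obtain ⟨C, hCA, hC, hs⟩ := R.exists_le_card_eq_kappa (R.isDavenportBound hD) A (by omega)
    refine R.exists_subsequence_of_zero_sum hCA hC hs fun B _ => ?_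
    by_cases hB0 : B = 0
    · have hid : IsIdentity (R.incl 0) := fun a => by
        rw [add_comm, R.add_incl, add_zero]
        exact hK a
      exact ⟨_, Or.inr ⟨hB0, hid⟩, hK _⟩
    · obtain ⟨s, hsB⟩ := exists_sumsTo B hB0
      exact ⟨s, hsB, hK s⟩
  push Not at hK
  have hrep : ∀ c, ¬ R.InKernel c → 3 ≤ D := by
    intro c hc
    obtain ⟨m, -, h2, hm, -⟩ := R.exists_sumsTo_replicate hc (n := D) (hD _ (by simp))
    omega
  obtain ⟨c₀, hc₀⟩ := hK
  have hD3 := hrep c₀ hc₀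
  -- a term in the kernel is put aside: it forces the sum of the remaining terms into the kernel
  by_cases hgA : ∃ g ∈ A, R.InKernel g
  · obtain ⟨g, hgA, hg⟩ := hgA
    obtain ⟨A, rfl⟩ := Multiset.exists_cons_of_mem hgA
    rw [Multiset.card_cons] at hA
    obtain ⟨C, hCA, hC, hs⟩ :=
      R.exists_le_card_eq_kappa (R.isDavenportBound_pred hc₀ hD) A (by omega)
    refine R.exists_subsequence_of_zero_sum (hCA.trans (Multiset.le_cons_self A g)) hC hs
      fun B hB => ?_
    have hgB : g ∈ B := by
      have h1 : (g ::ₘ (A - C)) + C = g ::ₘ A := by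
        rw [Multiset.cons_add, tsub_add_cancel_of_le hCA]
      rw [add_right_cancel (hB.trans h1.symm)]
      exact Multiset.mem_cons_self g _
    obtain ⟨s, hsB⟩ := exists_sumsTo B (by rintro rfl; simp at hgB)
    exact ⟨s, hsB, hg.of_mem hgB hsB⟩
  push Not at hgA
  by_cases hD4 : 4 ≤ D
  · obtain ⟨C, hCA, hC, hs⟩ := R.exists_le_card_eq_kappa (R.isDavenportBound hD) A (by omega)
    refine R.exists_subsequence_of_zero_sum hCA hC hs fun B hB => ?_
    have hBc : 3 ≤ B.card := by
      have := congrArg Multiset.card hB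
      rw [Multiset.card_add] at this
      omega
    obtain ⟨s, hsB⟩ := exists_sumsTo B (Multiset.card_pos.1 (by omega))
    exact ⟨s, hsB, R.inKernel_of_three_le_card hnil hBc hsB⟩
  obtain rfl : D = 3 := by omega
  -- reducibility of `c, c, c` gives `2c = 3c` in the kernel
  have htwo : ∀ c, ¬ R.InKernel c →
      R.proj c = 0 ∧ ∃ s, SumsTo (Multiset.replicate 2 c) s ∧ R.InKernel s := by
    intro c hc
    obtain ⟨m, s, h2, hm, hsK, h1, h3⟩ := R.exists_sumsTo_replicate hc (n := 3) (hD _ (by simp))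
    obtain rfl : m = 2 := by omega
    refine ⟨?_, s, h1, hsK⟩
    have h4 := (R.sum_map_proj h1).trans (R.sum_map_proj h3).symm
    simp only [Multiset.map_replicate, Multiset.sum_replicate] at h4
    rw [succ_nsmul _ 2] at h4
    exact left_eq_add.1 h4
  have hdup : ¬ A.Nodup := by
    intro hnd
    have h1 := Finset.card_le_univ (⟨A, hnd⟩ : Finset S)
    have h2 : (⟨A, hnd⟩ : Finset S).card = A.card := rfl
    have h3 := card_le_kappa S
    omega
  obtain ⟨c, hcA⟩ : ∃ c, Multiset.replicate 2 c ≤ A := by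
    by_contra! H
    exact hdup (Multiset.nodup_iff_le.2 fun c hc => H c (by simpa using hc))
  have hBC : A - Multiset.replicate 2 c + Multiset.replicate 2 c = A := tsub_add_cancel_of_le hcA
  refine R.exists_subsequence_of_zero_sum (C := A - Multiset.replicate 2 c) tsub_le_self ?_ ?_
    fun B hB => ?_
  · rw [Multiset.card_sub hcA, Multiset.card_replicate]
    omega
  · refine Multiset.sum_eq_zero fun x hx => ?_
    obtain ⟨a, ha, rfl⟩ := Multiset.mem_map.1 hx
    exact (htwo a (hgA a (Multiset.mem_of_le tsub_le_self ha))).1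
  · rw [add_comm] at hBC
    obtain rfl := add_right_cancel (hB.trans hBC.symm)
    exact (htwo c (hgA c (Multiset.mem_of_le hcA (by simp)))).2

end Structure

end ArchSemigroup

theorem theorem4p6 (S : Type*) [AddCommSemigroup S] [Fintype S] [Nonempty S]
    (hS : ArchSemigroup.IsArchimedean S) :
    ArchSemigroup.egz S ≤ ArchSemigroup.davenport S + (ArchSemigroup.kappa S : ℕ∞) ∧
    (ArchSemigroup.nilpotencyIndex
        (ArchSemigroup.ReesQuotient (ArchSemigroup.kernel S)) ≤ 3 →
      ArchSemigroup.egz S ≤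
        ArchSemigroup.davenport S + (ArchSemigroup.kappa S : ℕ∞) - 1) := by
  obtain ⟨G, _, ⟨R⟩⟩ := ArchSemigroup.exists_kernelRetraction hS
  obtain ⟨D, hD0, hDS, hD⟩ := ArchSemigroup.exists_davenport_eq S
  have hκ : 0 < ArchSemigroup.kappa S :=
    Fintype.card_pos.trans_le (ArchSemigroup.card_le_kappa S)
  rw [hDS]
  refine ⟨?_, fun hnil => ?_⟩
  · have h : ArchSemigroup.egz S ≤ ((D + ArchSemigroup.kappa S : ℕ) : ℕ∞) :=
      sInf_le ⟨_, ⟨by omega, R.exists_subsequence_of_card_eq hD0 hD⟩, rfl⟩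
    exact_mod_cast h
  · have h : ArchSemigroup.egz S ≤ ((D + ArchSemigroup.kappa S - 1 : ℕ) : ℕ∞) :=
      sInf_le ⟨_, ⟨by omega, fun A hA =>
        R.exists_subsequence_of_card_add_one_eq hnil hD A (by omega)⟩, rfl⟩
    exact_mod_cast h
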